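/- Let $\mathcal P$ be the set of all probability distributions supported on $[0,1]$; for $P\in\mathcal P$ and $\tilde v\sim P$ write $\bar P(x)=\mathbb P(\tilde v>x)$ and $\bar P_-(x)=\mathbb P(\tilde v\ge x)$. For $P,P_0\in\mathcal P$ let $d(P,P_0)=\int_0^1|\bar P(x)-\bar P_0(x)|\,\mathrm dx$ be the type-1 Wasserstein distance, and for $r\ge 0$ let $\mathcal W(P_0,r)=\{P\in\mathcal P: d(P,P_0)\le r\}$. Let $\mathcal M$ be the set of pairs $(q,m)$ of functions $q:[0,1]\to[0,1]$, $m:[0,1]\to\mathbb R$ that are individually rational, $q(v)v-m(v)\ge 0$ for all $v\in[0,1]$, and incentive compatible, $q(v)v-m(v)\ge q(\omega)v-m(\omega)$ for all $v,\omega\in[0,1]$. Let $\mathcal M_0$ be the set of pairs $(q,m)$ with $q:[0,1]\to[0,1]$ non-decreasing and $m(v)=\int_0^v x\,\mathrm dq(x)$ (Riemann–Stieltjes integral) for all $v\in[0,1]$. For every $(q,m)\in\mathcal M\cup\mathcal M_0$, $m$ is integrable with respect to every $P\in\mathcal P$; for every non-decreasing $q:[0,1]\to[0,1]$ the integrals $\int_0^v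 x\,\mathrm dq(x)$ exist and are unique; and for every $P\in\mathcal P$ the maximum $\max_{x\in[0,1]}x\bar P_-(x)$ is attained. For every $P_0\in\mathcal P$ and every $k>0$, $$\sup_{(q,m)\in\mathcal M}\ \inf_{P\in\mathcal P}\bigl[\mathbb E_P[m(\tilde v)]+k\,d(P,P_0)\bigr] =\sup_{(q,m)\in\mathcal M_0}\ \inf_{P\in\mathcal P}\Bigl[\mathbb E_P\Bigl[\int_0^{\tilde v}x\,\mathrm dq(x)\Bigr]+k\,d(P,P_0)\Bigr]$$ $$=\inf_{P\in\mathcal P}\Bigl[\max_{x\in[0,1]}x\,\bar P_-(x)+k\,d(P,P_0)\Bigr] =\inf_{r\ge 0}\Bigl\{\inf_{P\in\mathcal W(P_0,r)}\ \max_{x\in[0,1]}x\,\bar P_-(x)+k\,r\Bigr\}.$$ -/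

import Mathlib

open MeasureTheory
open scoped unitInterval

noncomputable section

namespace RobustScreening

/-- Direct mechanisms `(q, m)` with an allocation rule `q : [0,1] → [0,1]` and a payment rule
`m : [0,1] → ℝ` that are individually rational and incentive compatible. -/
def mechanisms : Set ((I → I) × (I → ℝ)) :=
  {M | (∀ v : I, 0 ≤ (M.1 v : ℝ) * v - M.2 v) ∧
    ∀ v w : I, (M.1 w : ℝ) * v - M.2 w ≤ (M.1 v : ℝ) * v - M.2 v}

/-- `J` is the Riemann–Stieltjes integral `∫_a^b f(x) dg(x)`: the limit, as the mesh tends to `0`,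
of the sums `∑ f(s i) (g(t (i+1)) - g(t i))` over the tagged partitions
`a = t 0 ≤ s 0 ≤ t 1 ≤ s 1 ≤ ... ≤ t n = b`. -/
def HasStieltjesIntegral (f g : I → ℝ) (a b : I) (J : ℝ) : Prop :=
  ∀ ε : ℝ, 0 < ε → ∃ δ : ℝ, 0 < δ ∧
    ∀ (n : ℕ) (t s : ℕ → I), t 0 = a → t n = b →
      (∀ i < n, t i ≤ s i ∧ s i ≤ t (i + 1) ∧ (t (i + 1) : ℝ) - t i < δ) →
      |∑ i ∈ Finset.range n, f (s i) * (g (t (i + 1)) - g (t i)) - J| < ε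

/-- Mechanisms in reduced form: `q` is non-decreasing and `m(v) = ∫_0^v x dq(x)`. -/
def reducedMechanisms : Set ((I → I) × (I → ℝ)) :=
  {M | Monotone M.1 ∧
    ∀ v : I, HasStieltjesIntegral (fun x => (x : ℝ)) (fun x => (M.1 x : ℝ)) 0 v (M.2 v)}

/-- The complementary cumulative distribution function `x ↦ P(ṽ > x)`. -/
def ccdf (P : ProbabilityMeasure I) (x : ℝ) : ℝ :=
  (P : Measure I).real {v : I | x < v}

/-- The type-1 Wasserstein distance `∫_0^1 |P̄(x) - P̄₀(x)| dx`. -/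
def wasserstein (P P₀ : ProbabilityMeasure I) : ℝ :=
  ∫ x in (0 : ℝ)..1, |ccdf P x - ccdf P₀ x|

/-- The Wasserstein ball of radius `r` around `P₀`. -/
def wassersteinBall (P₀ : ProbabilityMeasure I) (r : ℝ) : Set (ProbabilityMeasure I) :=
  {P | wasserstein P P₀ ≤ r}

/-- The expected revenue `x · P(ṽ ≥ x)` of the posted price `x`. -/
def revenue (P : ProbabilityMeasure I) (x : I) : ℝ :=
  (x : ℝ) * (P : Measure I).real {v : I | x ≤ v}

/-- The optimal posted-price revenue `max_{x ∈ [0,1]} x · P(ṽ ≥ x)`. -/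
def maxRevenue (P : ProbabilityMeasure I) : ℝ := ⨆ x : I, revenue P x

/-- The objective `E_P[m(ṽ)] + k d(P, P₀)`. -/
def adjustedRevenue (P₀ : ProbabilityMeasure I) (k : ℝ) (m : I → ℝ)
    (P : ProbabilityMeasure I) : ℝ :=
  (∫ v, m v ∂(P : Measure I)) + k * wasserstein P P₀

end RobustScreening

end

open RobustScreening

namespace RobustScreening

/-! The statement is a minimax equality between seller and adversary, proved by exhibiting nearly
optimal strategies for both sides.

Weak duality (`integral_payment_le_maxRevenue`): an incentive compatible mechanism earns no more
than a mixture of posted prices distributed according to dq, so against any P it earns at most the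
best posted-price revenue.

Strong duality (`exists_nearly_optimal`): write T for the tail of P₀. To keep every posted-price
revenue at most ρ, the adversary cuts T down to min(T, ρ/x), at total cost ρ + k ∫ (T - ρ/x)⁺. The
seller uses an allocation rule with density h satisfying x h(x) ≤ k. Its expected payment is ∫ x
h(x) P̄(x) dx, so lowering the tail saves the adversary no more than the transport costs, and P₀
itself is a worst case. With h = k/x where x T(x) > ρ, and 0 elsewhere, the seller's guarantee is ρ
∫ h + k ∫ (T - ρ/x)⁺. This matches the adversary's cost when ∫ h = 1. That mass may jump past 1 as ρ
varies, so `exists_density` averages two nearby thresholds and loses at most ε.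

For the reduced form, incentive compatibility forces m(v) - m(0) = ∫_0^v x dq, while individual
rationality gives m(0) ≤ 0, so normalizing m(0) = 0 only helps. The radius form merely optimizes
over the value of the distance. -/

/-! ### Incentive compatibility and Stieltjes payments -/

theorem payment_sub_le {M : (I → I) × (I → ℝ)} (hM : M ∈ mechanisms) (v w : I) :
    M.2 v - M.2 w ≤ ((M.1 v : ℝ) - M.1 w) * v := by
  have := hM.2 v w
  linarith

theorem le_payment_sub {M : (I → I) × (I → ℝ)} (hM : M ∈ mechanisms) (v w : I) :
    ((M.1 v : ℝ) - M.1 w) * w ≤ M.2 v - M.2 w := by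
  have := hM.2 w v
  linarith

theorem monotone_allocation {M : (I → I) × (I → ℝ)} (hM : M ∈ mechanisms) : Monotone M.1 := by
  intro w v hwv
  rcases hwv.eq_or_lt with rfl | h
  · rfl
  · have h1 := payment_sub_le hM v w
    have h2 := le_payment_sub hM v w
    have h3 : (w : ℝ) < v := h
    have h4 : (M.1 w : ℝ) ≤ M.1 v := by
      by_contra! h5
      nlinarith
    exact h4

theorem monotone_payment {M : (I → I) × (I → ℝ)} (hM : M ∈ mechanisms) : Monotone M.2 := by
  intro w v hwv
  have h1 : (M.1 w : ℝ) ≤ M.1 v := monotone_allocation hM hwv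
  have h2 := le_payment_sub hM v w
  have h3 := mul_nonneg (sub_nonneg.2 h1) w.2.1
  linarith

theorem payment_zero_nonpos {M : (I → I) × (I → ℝ)} (hM : M ∈ mechanisms) : M.2 0 ≤ 0 := by
  simpa using hM.1 0

theorem integrable_of_monotone {m : I → ℝ} (hm : Monotone m) (μ : Measure I)
    [IsFiniteMeasure μ] : Integrable m μ := by
  refine Integrable.of_bound hm.measurable.aestronglyMeasurable (max |m 0| |m 1|) ?_
  refine Filter.Eventually.of_forall fun v => ?_
  exact abs_le_max_abs_abs (hm v.2.1) (hm v.2.2)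

/-- On each cell, the payment increment and the tagged term both lie between Δq times the left
endpoint and Δq times the right one. The total error is thus at most the mesh times the increase of
q, which is at most 1; q need not be continuous. -/
theorem hasStieltjesIntegral_payment {M : (I → I) × (I → ℝ)} (hM : M ∈ mechanisms) (a b : I) :
    HasStieltjesIntegral (fun x => (x : ℝ)) (fun x => (M.1 x : ℝ)) a b (M.2 b - M.2 a) := by
  intro ε hε
  refine ⟨ε / 2, by positivity, fun n t s ht0 htn hts => ?_⟩
  have hJ : M.2 b - M.2 a = ∑ i ∈ Finset.range n, (M.2 (t (i + 1)) - M.2 (t i)) := by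
    rw [Finset.sum_range_sub (fun i => M.2 (t i)), ht0, htn]
  have hq : (M.1 b : ℝ) - M.1 a =
      ∑ i ∈ Finset.range n, ((M.1 (t (i + 1)) : ℝ) - M.1 (t i)) := by
    rw [Finset.sum_range_sub (fun i => (M.1 (t i) : ℝ)), ht0, htn]
  rw [hJ, ← Finset.sum_sub_distrib]
  calc _ ≤ ∑ i ∈ Finset.range n, ε / 2 * ((M.1 (t (i + 1)) : ℝ) - M.1 (t i)) := by
        refine (Finset.abs_sum_le_sum_abs _ _).trans (Finset.sum_le_sum fun i hi => ?_)
        obtain ⟨h1, h2, h3⟩ := hts i (Finset.mem_range.1 hi)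
        have hΔ : (M.1 (t i) : ℝ) ≤ M.1 (t (i + 1)) := monotone_allocation hM (h1.trans h2)
        have h4 := payment_sub_le hM (t (i + 1)) (t i)
        have h5 := le_payment_sub hM (t (i + 1)) (t i)
        have h1' : (t i : ℝ) ≤ s i := h1
        have h2' : (s i : ℝ) ≤ t (i + 1) := h2
        rw [abs_le]
        constructor <;> nlinarith
    _ = ε / 2 * ((M.1 b : ℝ) - M.1 a) := by rw [hq, Finset.mul_sum]
    _ ≤ ε / 2 * 1 := by
        gcongr
        linarith [(M.1 b).2.2, (M.1 a).2.1]
    _ < ε := by linarith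

theorem mem_reducedMechanisms_of_mem_mechanisms {M : (I → I) × (I → ℝ)} (hM : M ∈ mechanisms)
    (h0 : M.2 0 = 0) : M ∈ reducedMechanisms :=
  ⟨monotone_allocation hM, fun v => by
    simpa [h0] using hasStieltjesIntegral_payment hM 0 v⟩

/-- A uniform partition of [0, v] fine enough for both limits puts one sum close to both values. -/
theorem HasStieltjesIntegral.unique {f g : I → ℝ} {v : I} {J J' : ℝ}
    (h : HasStieltjesIntegral f g 0 v J) (h' : HasStieltjesIntegral f g 0 v J') : J = J' := by
  refine eq_of_forall_dist_le fun ε hε => ?_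
  obtain ⟨δ, hδ, H⟩ := h (ε / 2) (by positivity)
  obtain ⟨δ', hδ', H'⟩ := h' (ε / 2) (by positivity)
  obtain ⟨n, hn⟩ := exists_nat_one_div_lt (lt_min hδ hδ')
  let t : ℕ → I := fun i => v * Set.projIcc (0 : ℝ) 1 zero_le_one ((i : ℝ) / ((n : ℝ) + 1))
  have hn0 : (0 : ℝ) < (n : ℝ) + 1 := by positivity
  have ht0 : t 0 = 0 := by
    simp only [t, CharP.cast_eq_zero, zero_div, Set.projIcc_left]
    exact mul_zero v
  have htn : t (n + 1) = v := by
    simp only [t, Nat.cast_add, Nat.cast_one, div_self hn0.ne', Set.projIcc_right]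
    exact mul_one v
  have hval : ∀ i ≤ n + 1, (t i : ℝ) = v * ((i : ℝ) / ((n : ℝ) + 1)) := by
    intro i hi
    have : (i : ℝ) / ((n : ℝ) + 1) ∈ Set.Icc (0 : ℝ) 1 :=
      ⟨by positivity, (div_le_one hn0).2 (by exact_mod_cast hi)⟩
    simp only [t, Set.projIcc_of_mem zero_le_one this]
    rfl
  have hmesh : ∀ i < n + 1, (t (i + 1) : ℝ) - t i = v * (1 / ((n : ℝ) + 1)) := by
    intro i hi
    rw [hval i hi.le, hval (i + 1) hi]
    push_cast
    ring
  have hv : (v : ℝ) * (1 / ((n : ℝ) + 1)) ≤ 1 / ((n : ℝ) + 1) :=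
    mul_le_of_le_one_left (by positivity) v.2.2
  have hle : ∀ i < n + 1, t i ≤ t (i + 1) := by
    intro i hi
    have h1 : (0 : ℝ) ≤ v * (1 / ((n : ℝ) + 1)) := mul_nonneg v.2.1 (by positivity)
    have h2 : (t i : ℝ) ≤ t (i + 1) := by linarith [hmesh i hi]
    exact h2
  have h1 := H (n + 1) t t ht0 htn fun i hi => ⟨le_rfl, hle i hi, by
    rw [hmesh i hi]; exact hv.trans_lt (hn.trans_le (min_le_left _ _))⟩
  have h2 := H' (n + 1) t t ht0 htn fun i hi => ⟨le_rfl, hle i hi, by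
    rw [hmesh i hi]; exact hv.trans_lt (hn.trans_le (min_le_right _ _))⟩
  rw [abs_lt] at h1 h2
  rw [Real.dist_eq, abs_le]
  constructor <;> linarith

theorem exists_mem_mechanisms_of_monotone {q : I → I} (hq : Monotone q) :
    ∃ m : I → ℝ, (q, m) ∈ mechanisms ∧ m 0 = 0 := by
  let g : ℝ → ℝ := fun x => q (Set.projIcc 0 1 zero_le_one x)
  have hg : Monotone g := fun x y h => hq (Set.monotone_projIcc _ h)
  have hint : ∀ a b : ℝ, IntervalIntegrable g volume a b := fun a b => hg.intervalIntegrable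
  have hgv : ∀ v : I, g v = q v := fun v => by simp [g]
  -- Envelope formula: surplus minus the information rent ∫_0^v q.
  refine ⟨fun v => q v * v - ∫ x in (0 : ℝ)..v, g x, ⟨fun v => ?_, fun v w => ?_⟩, by simp⟩
  · have : 0 ≤ ∫ x in (0 : ℝ)..v, g x :=
      intervalIntegral.integral_nonneg v.2.1 fun x _ => (q _).2.1
    simpa using this
  · have key : (q w : ℝ) * (v - w) ≤ ∫ x in (w : ℝ)..v, g x := by
      rcases le_total w v with h | h
      · have := intervalIntegral.integral_mono_on (μ := volume) (f := fun _ => (q w : ℝ)) (g := g)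
          (a := w) (b := v) h (by simp) (hint _ _) (fun x hx => by rw [← hgv]; exact hg hx.1)
        simp only [intervalIntegral.integral_const, smul_eq_mul] at this
        linarith
      · have := intervalIntegral.integral_mono_on (μ := volume) (f := g) (g := fun _ => (q w : ℝ))
          (a := v) (b := w) h (hint _ _) (by simp) (fun x hx => by rw [← hgv]; exact hg hx.2)
        simp only [intervalIntegral.integral_const, smul_eq_mul] at this
        rw [intervalIntegral.integral_symm]
        linarith
    have hadd := intervalIntegral.integral_add_adjacent_intervals (hint 0 w) (hint w v)
    simp only
    linarith

theorem reducedMechanisms_subset :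
    reducedMechanisms ⊆ mechanisms := by
  rintro ⟨q, m⟩ h
  obtain ⟨m', hm', h0⟩ := exists_mem_mechanisms_of_monotone h.1
  have : m = m' := funext fun v =>
    (h.2 v).unique ((mem_reducedMechanisms_of_mem_mechanisms hm' h0).2 v)
  rwa [this]

theorem existsUnique_reducedMechanism {q : I → I} (hq : Monotone q) :
    ∃! m : I → ℝ, (q, m) ∈ reducedMechanisms := by
  obtain ⟨m, hm, h0⟩ := exists_mem_mechanisms_of_monotone hq
  have hr := mem_reducedMechanisms_of_mem_mechanisms hm h0
  exact ⟨m, hr, fun m' hm' => funext fun v => (hm'.2 v).unique (hr.2 v)⟩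

theorem exists_reducedMechanism_ge {M : (I → I) × (I → ℝ)} (hM : M ∈ mechanisms) :
    ∃ M' ∈ reducedMechanisms, ∀ v, M.2 v ≤ M'.2 v := by
  have h0 := payment_zero_nonpos hM
  obtain ⟨m, hm, h1⟩ := exists_mem_mechanisms_of_monotone (monotone_allocation hM)
  refine ⟨_, mem_reducedMechanisms_of_mem_mechanisms hm h1, fun v => ?_⟩
  have := (hasStieltjesIntegral_payment hM 0 v).unique (hasStieltjesIntegral_payment hm 0 v)
  simp only at this ⊢
  linarith

/-! ### One-sided continuity of tails; attainment of the optimal posted price -/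

theorem exists_measureReal_le_lt_add (P : Measure I) [IsFiniteMeasure P] (x : I) {η : ℝ}
    (hη : 0 < η) :
    ∃ y : ℝ, y < x ∧ P.real {v : I | y ≤ v} < P.real {v : I | x ≤ v} + η := by
  have hmeas : ∀ n : ℕ, MeasurableSet {v : I | (x : ℝ) - 1 / ((n : ℝ) + 1) ≤ v} := fun n =>
    measurableSet_le measurable_const measurable_subtype_coe
  have hlim := tendsto_measure_iInter_atTop (μ := P)
    (s := fun n : ℕ => {v : I | (x : ℝ) - 1 / ((n : ℝ) + 1) ≤ v})
    (fun n => (hmeas n).nullMeasurableSet)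
    (fun n n' h v hv => by
      have := one_div_le_one_div_of_le (by positivity : (0 : ℝ) < (n : ℝ) + 1)
        (by gcongr : (n : ℝ) + 1 ≤ n' + 1)
      simp only [Set.mem_ofPred_eq] at hv ⊢
      linarith) ⟨0, measure_ne_top _ _⟩
  have hI : (⋂ n : ℕ, {v : I | (x : ℝ) - 1 / ((n : ℝ) + 1) ≤ v}) = {v : I | x ≤ v} := by
    ext v
    simp only [Set.mem_iInter, Set.mem_ofPred_eq]
    constructor
    · intro h
      by_contra! hlt
      obtain ⟨n, hn⟩ := exists_nat_one_div_lt (sub_pos.2 (show (v : ℝ) < x from hlt))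
      linarith [h n]
    · intro h n
      have h1 : (x : ℝ) ≤ v := h
      have h2 : 0 < 1 / ((n : ℝ) + 1) := by positivity
      linarith
  rw [hI] at hlim
  have hlim' := (ENNReal.tendsto_toReal (measure_ne_top P _)).comp hlim
  obtain ⟨n, hn⟩ := (hlim'.eventually (gt_mem_nhds (lt_add_of_pos_right _ hη))).exists
  exact ⟨_, sub_lt_self _ (by positivity), hn⟩

theorem exists_lt_measureReal_le_add (P : Measure I) [IsFiniteMeasure P] (x : ℝ) {c : ℝ}
    (hc : c < P.real {v : I | x < v}) :
    ∃ y : ℝ, x < y ∧ c < P.real {v : I | y ≤ v} := by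
  have hlim := tendsto_measure_iUnion_atTop (μ := P)
    (s := fun n : ℕ => {v : I | x + 1 / ((n : ℝ) + 1) ≤ v})
    (fun n n' h v hv => by
      have := one_div_le_one_div_of_le (by positivity : (0 : ℝ) < (n : ℝ) + 1)
        (by gcongr : (n : ℝ) + 1 ≤ n' + 1)
      simp only [Set.mem_ofPred_eq] at hv ⊢
      linarith)
  have hI : (⋃ n : ℕ, {v : I | x + 1 / ((n : ℝ) + 1) ≤ v}) = {v : I | x < v} := by
    ext v
    simp only [Set.mem_iUnion, Set.mem_ofPred_eq]
    constructor
    · rintro ⟨n, hn⟩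
      have h2 : 0 < 1 / ((n : ℝ) + 1) := by positivity
      linarith
    · intro h
      obtain ⟨n, hn⟩ := exists_nat_one_div_lt (sub_pos.2 h)
      exact ⟨n, by linarith⟩
  rw [hI] at hlim
  have hlim' := (ENNReal.tendsto_toReal (measure_ne_top P _)).comp hlim
  obtain ⟨n, hn⟩ := (hlim'.eventually (lt_mem_nhds hc)).exists
  exact ⟨_, lt_add_of_pos_right _ (by positivity), hn⟩

/-- The closed tail is left-continuous and non-increasing, so it can only jump down to the right;
this suffices for a maximum on a compact set. -/
theorem upperSemicontinuous_revenue (P : ProbabilityMeasure I) :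
    UpperSemicontinuous (revenue P) := by
  intro x c hc
  have hg0 : 0 ≤ (P : Measure I).real {v : I | x ≤ v} := measureReal_nonneg
  have hg1 : (P : Measure I).real {v : I | x ≤ v} ≤ 1 := measureReal_le_one
  unfold revenue at hc
  set g := (P : Measure I).real {v : I | x ≤ v}
  -- The 3 comes from (x + η)(g + η) ≤ x g + 3η, valid as x, g, η ≤ 1.
  obtain ⟨η, hη, hη1, hη2⟩ : ∃ η > 0, η ≤ 1 ∧ (x * g : ℝ) + 3 * η < c :=
    ⟨min 1 ((c - x * g) / 4), lt_min one_pos (by linarith), min_le_left _ _, by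
      linarith [min_le_right 1 ((c - x * g) / 4)]⟩
  obtain ⟨y, hy, hyη⟩ := exists_measureReal_le_lt_add (P : Measure I) x hη
  have hc0 : Continuous fun z : I => (z : ℝ) := continuous_subtype_val
  filter_upwards [hc0.continuousAt.eventually (lt_mem_nhds hy),
    hc0.continuousAt.eventually (gt_mem_nhds (lt_add_of_pos_right (x : ℝ) hη))] with z hz1 hz2
  have h1 : (P : Measure I).real {v : I | z ≤ v} ≤ (P : Measure I).real {v : I | y ≤ v} :=
    measureReal_mono fun v hv => hz1.le.trans hv
  calc revenue P z ≤ (x + η) * (g + η) :=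
        mul_le_mul hz2.le (h1.trans hyη.le) measureReal_nonneg (by linarith [x.2.1])
    _ ≤ x * g + 3 * η := by nlinarith [x.2.1, x.2.2]
    _ < c := hη2

theorem isGreatest_maxRevenue (P : ProbabilityMeasure I) :
    IsGreatest (Set.range (revenue P)) (maxRevenue P) := by
  obtain ⟨x, -, hx⟩ := UpperSemicontinuousOn.exists_isMaxOn Set.univ_nonempty isCompact_univ
    ((upperSemicontinuous_revenue P).upperSemicontinuousOn _)
  have hG : IsGreatest (Set.range (revenue P)) (revenue P x) :=
    ⟨⟨x, rfl⟩, by rintro _ ⟨y, rfl⟩; exact hx (Set.mem_univ y)⟩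
  rwa [maxRevenue, iSup, hG.csSup_eq]

theorem revenue_le_maxRevenue (P : ProbabilityMeasure I) (x : I) :
    revenue P x ≤ maxRevenue P :=
  (isGreatest_maxRevenue P).2 ⟨x, rfl⟩

theorem maxRevenue_le {P : ProbabilityMeasure I} {c : ℝ} (h : ∀ x, revenue P x ≤ c) :
    maxRevenue P ≤ c := by
  obtain ⟨x, hx⟩ := (isGreatest_maxRevenue P).1
  exact hx ▸ h x

theorem maxRevenue_nonneg (P : ProbabilityMeasure I) : 0 ≤ maxRevenue P :=
  (mul_nonneg (0 : I).2.1 measureReal_nonneg).trans (revenue_le_maxRevenue P 0)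

/-! ### Weak duality -/

/-- A mechanism is dominated by a mixture of posted prices on a grid, up to the mesh. -/
theorem integral_payment_le_maxRevenue {M : (I → I) × (I → ℝ)} (hM : M ∈ mechanisms)
    (P : ProbabilityMeasure I) : ∫ v, M.2 v ∂(P : Measure I) ≤ maxRevenue P := by
  refine le_of_forall_pos_le_add fun ε hε => ?_
  obtain ⟨n, hn⟩ := exists_nat_one_div_lt hε
  have hn0 : (0 : ℝ) < (n : ℝ) + 1 := by positivity
  let x : ℕ → I := fun i => Set.projIcc (0 : ℝ) 1 zero_le_one ((i : ℝ) / ((n : ℝ) + 1))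
  have hx0 : x 0 = 0 := by
    simp only [x, CharP.cast_eq_zero, zero_div, Set.projIcc_left]; rfl
  have hxn : x (n + 1) = 1 := by
    simp only [x, Nat.cast_add, Nat.cast_one, div_self hn0.ne', Set.projIcc_right]; rfl
  have hxmono : ∀ i, x i ≤ x (i + 1) := fun i =>
    Set.monotone_projIcc _ (by push_cast; gcongr; linarith)
  have hstep : ∀ i, (x (i + 1) : ℝ) ≤ x i + 1 / ((n : ℝ) + 1) := by
    intro i
    have h0 : 0 ≤ 1 / ((n : ℝ) + 1) := by positivity
    simp only [x, Set.coe_projIcc, Nat.cast_add, Nat.cast_one, add_div]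
    refine max_le (add_nonneg (le_max_left _ _) h0) ?_
    rcases le_total 1 ((i : ℝ) / ((n : ℝ) + 1)) with h | h
    · rw [min_eq_left h]
      exact (min_le_left _ _).trans ((le_max_right _ _).trans (le_add_of_nonneg_right h0))
    · rw [min_eq_right h]
      exact (min_le_right _ _).trans (by gcongr; exact le_max_right _ _)
  let Δ : ℕ → ℝ := fun i => (M.1 (x (i + 1)) : ℝ) - M.1 (x i)
  have hΔ : ∀ i, 0 ≤ Δ i := fun i => sub_nonneg.2 (monotone_allocation hM (hxmono i))
  have hΔsum : ∑ i ∈ Finset.range (n + 1), Δ i ≤ 1 := by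
    simp only [Δ]
    rw [Finset.sum_range_sub (fun i => (M.1 (x i) : ℝ))]
    linarith [(M.1 (x (n + 1))).2.2, (M.1 (x 0)).2.1]
  have hpt : ∀ v, M.2 v ≤ ∑ i ∈ Finset.range (n + 1),
      (Δ i * x i * (Set.Ici (x i)).indicator 1 v + Δ i * (1 / ((n : ℝ) + 1))) := by
    intro v
    -- Capping the grid at v makes the increments of cells starting above v vanish, which produces
    -- the indicators of posted prices.
    have htel : M.2 v - M.2 0 =
        ∑ i ∈ Finset.range (n + 1), (M.2 (min v (x (i + 1))) - M.2 (min v (x i))) := by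
      rw [Finset.sum_range_sub (fun i => M.2 (min v (x i))), hx0, hxn,
        min_eq_left (show v ≤ 1 from v.2.2), min_eq_right (show 0 ≤ v from v.2.1)]
    have h0 := payment_zero_nonpos hM
    refine (show M.2 v ≤ M.2 v - M.2 0 by linarith).trans (htel.trans_le ?_)
    refine Finset.sum_le_sum fun i _ => ?_
    have hpos : 0 ≤ Δ i * (1 / ((n : ℝ) + 1)) := mul_nonneg (hΔ i) (by positivity)
    by_cases hv : x i ≤ v
    · rw [Set.indicator_of_mem (show v ∈ Set.Ici (x i) from hv), min_eq_right hv]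
      have h1 := payment_sub_le hM (min v (x (i + 1))) (x i)
      have h2 : (M.1 (min v (x (i + 1))) : ℝ) ≤ M.1 (x (i + 1)) :=
        monotone_allocation hM (min_le_right _ _)
      have h3 : ((min v (x (i + 1)) : I) : ℝ) ≤ x (i + 1) := min_le_right v (x (i + 1))
      have h4 : ((M.1 (min v (x (i + 1))) : ℝ) - M.1 (x i)) * (min v (x (i + 1)) : I) ≤
          Δ i * x (i + 1) := mul_le_mul (by simp only [Δ]; linarith) h3 (min v (x (i + 1))).2.1
            (hΔ i)
      have h5 := mul_le_mul_of_nonneg_left (hstep i) (hΔ i)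
      simp only [Pi.one_apply]
      linarith
    · rw [Set.indicator_of_notMem (show v ∉ Set.Ici (x i) from hv)]
      push Not at hv
      rw [min_eq_left hv.le, min_eq_left (hv.le.trans (hxmono i))]
      simpa using hpos
  have hind : ∀ i, Integrable (fun v => Δ i * x i * (Set.Ici (x i)).indicator (1 : I → ℝ) v)
      (P : Measure I) := fun i =>
    ((integrable_const (1 : ℝ)).indicator measurableSet_Ici).const_mul _
  calc ∫ v, M.2 v ∂(P : Measure I)
      ≤ ∫ v, ∑ i ∈ Finset.range (n + 1),
        (Δ i * x i * (Set.Ici (x i)).indicator 1 v + Δ i * (1 / ((n : ℝ) + 1))) ∂(P : Measure I) :=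
        integral_mono (integrable_of_monotone (monotone_payment hM) _)
          (integrable_finsetSum _ fun i _ => (hind i).add (integrable_const _)) hpt
    _ = ∑ i ∈ Finset.range (n + 1), Δ i * (revenue P (x i) + 1 / ((n : ℝ) + 1)) := by
        refine (integral_finsetSum _ fun i _ => (hind i).add (integrable_const _)).trans ?_
        refine Finset.sum_congr rfl fun i _ => ?_
        rw [integral_add' (hind i) (integrable_const _), integral_const_mul,
          integral_indicator_one measurableSet_Ici]
        simp only [integral_const, probReal_univ, smul_eq_mul, revenue]
        change _ * (P : Measure I).real {v : I | x i ≤ v} + _ = _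
        ring
    _ ≤ ∑ i ∈ Finset.range (n + 1), Δ i * (maxRevenue P + 1 / ((n : ℝ) + 1)) := by
        gcongr with i
        · exact hΔ i
        · exact revenue_le_maxRevenue P _
    _ ≤ 1 * (maxRevenue P + 1 / ((n : ℝ) + 1)) := by
        rw [← Finset.sum_mul]
        exact mul_le_mul_of_nonneg_right hΔsum
          (add_nonneg (maxRevenue_nonneg P) (by positivity))
    _ ≤ maxRevenue P + ε := by
        rw [one_mul]
        gcongr

/-! ### The adversary: truncated tails -/

theorem antitone_ccdf (P : ProbabilityMeasure I) : Antitone (ccdf P) :=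
  fun _ _ h => measureReal_mono fun _ hv => lt_of_le_of_lt h hv

theorem ccdf_nonneg (P : ProbabilityMeasure I) (x : ℝ) : 0 ≤ ccdf P x := measureReal_nonneg

theorem ccdf_le_one (P : ProbabilityMeasure I) (x : ℝ) : ccdf P x ≤ 1 := measureReal_le_one

theorem volume_real_setOf_lt {c : ℝ} (h0 : 0 ≤ c) (h1 : c ≤ 1) :
    (volume : Measure I).real {u : I | (u : ℝ) < c} = c := by
  have : {u : I | (u : ℝ) < c} = Set.Iio ⟨c, h0, h1⟩ := rfl
  rw [this, measureReal_def, unitInterval.volume_Iio, ENNReal.toReal_ofReal h0]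

theorem volume_real_setOf_le_le {c : ℝ} (h0 : 0 ≤ c) :
    (volume : Measure I).real {u : I | (u : ℝ) ≤ c} ≤ c := by
  rcases le_total c 1 with h1 | h1
  · have : {u : I | (u : ℝ) ≤ c} = Set.Iic ⟨c, h0, h1⟩ := rfl
    rw [this, measureReal_def, unitInterval.volume_Iic, ENNReal.toReal_ofReal h0]
  · exact measureReal_le_one.trans h1

/-- The distribution with tail function `min (P̄₀ x) (ρ / x)`, built by quantile sampling. -/
theorem exists_truncated_distribution (P₀ : ProbabilityMeasure I) {ρ : ℝ} (hρ : 0 < ρ) :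
    ∃ P : ProbabilityMeasure I, (∀ x : ℝ, 0 < x → ccdf P x = min (ccdf P₀ x) (ρ / x)) ∧
      maxRevenue P ≤ ρ := by
  -- `G` is the target tail in closed form and `Y` its generalized inverse. Since ρ / 0 = 0 here, y
  -- = 0 never enters the set defining `Y`; this is harmless, as the supremum of the empty set in
  -- `I` is 0.
  let G : I → ℝ := fun y => min ((P₀ : Measure I).real {v : I | y ≤ v}) (ρ / y)
  let Y : I → I := fun u => sSup {y : I | (u : ℝ) < G y}
  have hY : Antitone Y := fun u u' h => sSup_le_sSup fun y hy =>
    lt_of_le_of_lt (show (u : ℝ) ≤ u' from h) hy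
  have hYm : Measurable Y := hY.measurable
  let P : ProbabilityMeasure I := ⟨(volume : Measure I).map Y,
    Measure.isProbabilityMeasure_map hYm.aemeasurable⟩
  have hP : ∀ s : Set I, MeasurableSet s → (P : Measure I).real s = volume.real (Y ⁻¹' s) :=
    fun s hs => map_measureReal_apply hYm hs
  refine ⟨P, fun x hx => ?_, maxRevenue_le fun x => ?_⟩
  · have hset : Y ⁻¹' {v : I | x < v} = {u : I | (u : ℝ) < min (ccdf P₀ x) (ρ / x)} := by
      ext u
      simp only [Set.mem_preimage, Set.mem_ofPred_eq]
      constructor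
      · intro h
        have hx1 : x ≤ 1 := h.le.trans (Y u).2.2
        have h' : (⟨x, hx.le, hx1⟩ : I) < Y u := h
        obtain ⟨y, hy, hxy⟩ := lt_sSup_iff.1 h'
        have hxy' : x < y := hxy
        refine lt_of_lt_of_le hy (min_le_min (measureReal_mono fun v hv => ?_) ?_)
        · exact hxy'.trans_le (show (y : ℝ) ≤ v from hv)
        · gcongr
      · intro h
        obtain ⟨h1, h2⟩ := lt_min_iff.1 h
        obtain ⟨y, hxy, hy⟩ := exists_lt_measureReal_le_add (P₀ : Measure I) x h1
        rw [lt_div_iff₀ hx] at h2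
        have hu0 := u.2.1
        have hu1 := u.2.2
        -- A point strictly above x: z ≤ y keeps the tail above u, and the second bound keeps u z <
        -- ρ because u ≤ 1.
        set z := min y (x + (ρ - u * x) / 2) with hz
        have hxz : x < z := lt_min hxy (by linarith)
        have hzy : z ≤ y := min_le_left _ _
        have hzx : z ≤ x + (ρ - u * x) / 2 := min_le_right _ _
        have hyne : {v : I | y ≤ v}.Nonempty := by
          by_contra hne
          rw [Set.not_nonempty_iff_eq_empty] at hne
          rw [hne, measureReal_empty] at hy
          linarith
        obtain ⟨v, hv⟩ := hyne
        have hz1 : z ≤ 1 := hzy.trans (le_trans hv v.2.2)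
        have hz0 : 0 < z := hx.trans hxz
        have hlt : (⟨x, hx.le, hxz.le.trans hz1⟩ : I) < Y u := by
          refine lt_sSup_iff.2 ⟨⟨z, hz0.le, hz1⟩, ?_, hxz⟩
          refine lt_min (a := (u : ℝ)) ?_ ?_
          · exact hy.trans_le (measureReal_mono fun v hv => le_trans hzy hv)
          · rw [lt_div_iff₀ hz0]
            nlinarith
        exact hlt
    rw [ccdf, hP _ (measurableSet_lt measurable_const measurable_subtype_coe), hset,
      volume_real_setOf_lt (le_min (ccdf_nonneg _ _) (by positivity))
        ((min_le_left _ _).trans (ccdf_le_one _ _))]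
  · rcases x.2.1.eq_or_lt with h0 | hx
    · simp only [revenue, ← h0, zero_mul]
      exact hρ.le
    · have hsub : Y ⁻¹' {v : I | x ≤ v} ⊆ {u : I | (u : ℝ) ≤ ρ / x} := by
        intro u hu
        by_contra hlt
        simp only [Set.mem_ofPred_eq, not_le] at hlt
        have hu0 : (0 : ℝ) < u := lt_trans (by positivity) hlt
        have hc : ρ / u < x := (div_lt_comm₀ hu0 hx).2 hlt
        have hle : Y u ≤ ⟨ρ / u, by positivity, hc.le.trans x.2.2⟩ := by
          refine sSup_le fun y hy => ?_
          have hy' : (u : ℝ) < ρ / y := lt_of_lt_of_le hy (min_le_right _ _)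
          rcases y.2.1.eq_or_lt with hy0 | hy0
          · rw [← hy0, div_zero] at hy'
            linarith
          · exact ((lt_div_comm₀ hu0 hy0).1 hy').le
        have h1 : (Y u : ℝ) ≤ ρ / u := hle
        have h2 : (x : ℝ) ≤ Y u := hu
        linarith
      rw [revenue, hP {v : I | x ≤ v} measurableSet_Ici]
      calc (x : ℝ) * volume.real (Y ⁻¹' {v : I | x ≤ v}) ≤ x * (ρ / x) := by
            gcongr
            exact (measureReal_mono hsub).trans (volume_real_setOf_le_le (by positivity))
        _ = ρ := by field_simp

theorem exists_maxRevenue_add_wasserstein_le (P₀ : ProbabilityMeasure I) (k : ℝ) {ρ : ℝ}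
    (hρ : 0 < ρ) :
    ∃ P : ProbabilityMeasure I, maxRevenue P + k * wasserstein P P₀ ≤
      ρ + k * ∫ x in (0 : ℝ)..1, max 0 (ccdf P₀ x - ρ / x) := by
  obtain ⟨P, hP, hr⟩ := exists_truncated_distribution P₀ hρ
  refine ⟨P, ?_⟩
  have : wasserstein P P₀ = ∫ x in (0 : ℝ)..1, max 0 (ccdf P₀ x - ρ / x) := by
    refine intervalIntegral.integral_congr_ae (Filter.Eventually.of_forall fun x hx => ?_)
    rw [Set.uIoc_of_le zero_le_one] at hx
    rw [hP x hx.1]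
    rcases le_total (ccdf P₀ x) (ρ / x) with h | h
    · rw [min_eq_left h, max_eq_left (by linarith)]
      simp
    · rw [min_eq_right h, max_eq_right (by linarith), abs_of_nonpos (by linarith)]
      ring
  rw [this]
  linarith

/-! ### The seller: guarantee from an allocation density -/

theorem intervalIntegrable_abs_ccdf_sub (P P₀ : ProbabilityMeasure I) :
    IntervalIntegrable (fun x => |ccdf P x - ccdf P₀ x|) volume 0 1 :=
  ((antitone_ccdf P).intervalIntegrable.sub (antitone_ccdf P₀).intervalIntegrable).abs

theorem intervalIntegrable_of_measurable_of_bound {f : ℝ → ℝ} (hf : Measurable f) {C : ℝ}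
    {a b : ℝ} (h0 : 0 ≤ a) (hab : a ≤ b) (hb : b ≤ 1) (hC : ∀ x ∈ Set.Ioc (0 : ℝ) 1, |f x| ≤ C) :
    IntervalIntegrable f volume a b := by
  rw [intervalIntegrable_iff_integrableOn_Ioc_of_le hab]
  refine IntegrableOn.of_bound measure_Ioc_lt_top hf.aestronglyMeasurable C ?_
  filter_upwards [ae_restrict_mem measurableSet_Ioc] with x hx
  exact hC x ⟨h0.trans_lt hx.1, hx.2.trans hb⟩

/-- The expectation of `∫_0^v g` is the integral of `g` against the tail function. -/
theorem integral_intervalIntegral_eq (P : ProbabilityMeasure I) {g : ℝ → ℝ} (hg : Measurable g)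
    {C : ℝ} (hC : ∀ x ∈ Set.Ioc (0 : ℝ) 1, |g x| ≤ C) :
    ∫ v : I, (∫ x in (0 : ℝ)..v, g x) ∂(P : Measure I) = ∫ x in (0 : ℝ)..1, g x * ccdf P x := by
  have hm : MeasurableSet {p : I × ℝ | p.2 < (p.1 : ℝ)} :=
    measurableSet_lt measurable_snd (measurable_subtype_coe.comp measurable_fst)
  have hv : ∀ v : I, ∫ x in (0 : ℝ)..v, g x =
      ∫ x in Set.Ioc (0 : ℝ) 1, {p : I × ℝ | p.2 < (p.1 : ℝ)}.indicator (fun p => g p.2) (v, x) := by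
    intro v
    have h1 : ∀ x, {p : I × ℝ | p.2 < (p.1 : ℝ)}.indicator (fun p => g p.2) (v, x) =
        (Set.Iio (v : ℝ)).indicator g x := fun x => rfl
    simp_rw [h1]
    rw [setIntegral_indicator measurableSet_Iio, intervalIntegral.integral_of_le v.2.1,
      integral_Ioc_eq_integral_Ioo]
    congr 2
    ext x
    simp only [Set.mem_Ioo, Set.mem_inter_iff, Set.mem_Ioc, Set.mem_Iio]
    have := v.2.2
    constructor
    · rintro ⟨h, h'⟩
      exact ⟨⟨h, by linarith⟩, h'⟩
    · rintro ⟨⟨h, -⟩, h'⟩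
      exact ⟨h, h'⟩
  have hint : Integrable (Function.uncurry fun (v : I) (x : ℝ) =>
      {p : I × ℝ | p.2 < (p.1 : ℝ)}.indicator (fun p => g p.2) (v, x))
      ((P : Measure I).prod (volume.restrict (Set.Ioc (0 : ℝ) 1))) := by
    refine Integrable.of_bound
      ((hg.comp measurable_snd).indicator hm).aestronglyMeasurable C ?_
    have hae : ∀ᵐ p ∂((P : Measure I).prod (volume.restrict (Set.Ioc (0 : ℝ) 1))),
        p.2 ∈ Set.Ioc (0 : ℝ) 1 :=
      Measure.quasiMeasurePreserving_snd.ae (ae_restrict_mem measurableSet_Ioc)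
    filter_upwards [hae] with p hp
    exact (norm_indicator_le_norm_self (fun p : I × ℝ => g p.2) p).trans (hC _ hp)
  simp_rw [hv]
  rw [integral_integral_swap hint, intervalIntegral.integral_of_le zero_le_one]
  congr 1
  ext x
  have h1 : ∀ v : I, {p : I × ℝ | p.2 < (p.1 : ℝ)}.indicator (fun p => g p.2) (v, x) =
      {v : I | x < v}.indicator (fun _ => g x) v := fun v => rfl
  simp_rw [h1]
  rw [integral_indicator_const _ (measurableSet_lt measurable_const measurable_subtype_coe)]
  exact mul_comm _ _

/-- The mechanism with allocation density `h`, bounded and with `x h(x) ≤ k`, guarantees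
`∫ x h(x) P̄₀(x) dx`. -/
theorem exists_mechanism_of_density (P₀ : ProbabilityMeasure I) {k : ℝ} {h : ℝ → ℝ}
    (hm : Measurable h) (h0 : ∀ x, 0 ≤ h x) {C : ℝ} (hC : ∀ x, h x ≤ C)
    (hk : ∀ x ∈ Set.Ioc (0 : ℝ) 1, x * h x ≤ k) (h1 : ∫ x in (0 : ℝ)..1, h x ≤ 1) :
    ∃ M ∈ mechanisms, ∀ P, ∫ x in (0 : ℝ)..1, x * h x * ccdf P₀ x ≤
      adjustedRevenue P₀ k M.2 P := by
  have hxm : Measurable fun x => x * h x := measurable_id.mul hm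
  have hxb : ∀ x ∈ Set.Ioc (0 : ℝ) 1, |x * h x| ≤ k := fun x hx => by
    rw [abs_of_nonneg (mul_nonneg hx.1.le (h0 x))]
    exact hk x hx
  have hint : ∀ a b : I, IntervalIntegrable h volume a b := by
    have : ∀ a b : I, a ≤ b → IntervalIntegrable h volume a b := fun a b hab =>
      intervalIntegrable_of_measurable_of_bound hm a.2.1 hab b.2.2 (C := C) fun x _ => by
        rw [abs_of_nonneg (h0 x)]; exact hC x
    exact fun a b => (le_total a b).elim (this a b) fun h => (this b a h).symm
  have hxint : ∀ a b : I, IntervalIntegrable (fun x => x * h x) volume a b := by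
    have : ∀ a b : I, a ≤ b → IntervalIntegrable (fun x => x * h x) volume a b := fun a b hab =>
      intervalIntegrable_of_measurable_of_bound hxm a.2.1 hab b.2.2 hxb
    exact fun a b => (le_total a b).elim (this a b) fun h => (this b a h).symm
  -- Holds for either order of v and w, so it yields both individual rationality and incentive
  -- compatibility.
  have hstep : ∀ v w : I, ∫ x in (w : ℝ)..v, x * h x ≤ (∫ x in (w : ℝ)..v, h x) * v := by
    intro v w
    rw [← intervalIntegral.integral_mul_const]
    rcases le_total w v with hwv | hwv
    · refine intervalIntegral.integral_mono_on hwv (hxint _ _) ((hint _ _).mul_const _)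
        fun x hx => ?_
      rw [mul_comm]
      exact mul_le_mul_of_nonneg_left hx.2 (h0 x)
    · rw [intervalIntegral.integral_symm, intervalIntegral.integral_symm (v : ℝ)]
      refine neg_le_neg ?_
      refine intervalIntegral.integral_mono_on hwv ((hint _ _).mul_const _) (hxint _ _)
        fun x hx => ?_
      rw [mul_comm x]
      exact mul_le_mul_of_nonneg_left hx.1 (h0 x)
  have hq : ∀ v : I, ∫ x in (0 : ℝ)..v, h x ∈ Set.Icc (0 : ℝ) 1 := by
    intro v
    refine ⟨intervalIntegral.integral_nonneg v.2.1 fun x _ => h0 x, ?_⟩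
    have hadd := intervalIntegral.integral_add_adjacent_intervals (hint 0 v) (hint v 1)
    have hnn : 0 ≤ ∫ x in (v : ℝ)..(1 : I), h x :=
      intervalIntegral.integral_nonneg v.2.2 fun x _ => h0 x
    simp only [Set.Icc.coe_zero, Set.Icc.coe_one] at hadd hnn
    linarith
  refine ⟨(fun v => ⟨∫ x in (0 : ℝ)..v, h x, hq v⟩, fun v => ∫ x in (0 : ℝ)..v, x * h x),
    ⟨fun v => ?_, fun v w => ?_⟩, fun P => ?_⟩
  · have := hstep v 0
    simp only [Set.Icc.coe_zero] at this ⊢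
    linarith
  · have h2 := hstep v w
    have h3 := intervalIntegral.integral_add_adjacent_intervals (hint 0 w) (hint w v)
    have h4 := intervalIntegral.integral_add_adjacent_intervals (hxint 0 w) (hxint w v)
    simp only [Set.Icc.coe_zero] at h3 h4 ⊢
    rw [← h3, ← h4]
    linarith
  · simp only [adjustedRevenue]
    have hmulint : ∀ Q : ProbabilityMeasure I,
        IntervalIntegrable (fun x => x * h x * ccdf Q x) volume 0 1 := fun Q =>
      intervalIntegrable_of_measurable_of_bound (C := k)
        (hxm.mul (antitone_ccdf Q).measurable) le_rfl zero_le_one le_rfl fun x hx => by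
          rw [Pi.mul_apply, abs_mul, abs_of_nonneg (ccdf_nonneg Q x)]
          exact (mul_le_of_le_one_right (abs_nonneg _) (ccdf_le_one Q x)).trans (hxb x hx)
    rw [integral_intervalIntegral_eq P hxm hxb, wasserstein,
      ← intervalIntegral.integral_const_mul, ← intervalIntegral.integral_add (hmulint P)
        ((intervalIntegrable_abs_ccdf_sub P P₀).const_mul k)]
    refine intervalIntegral.integral_mono_on_of_le_Ioo zero_le_one (hmulint P₀)
      ((hmulint P).add ((intervalIntegrable_abs_ccdf_sub P P₀).const_mul k)) fun x hx => ?_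
    have hx' : x ∈ Set.Ioc (0 : ℝ) 1 := ⟨hx.1, hx.2.le⟩
    have h5 : x * h x * (ccdf P₀ x - ccdf P x) ≤ k * |ccdf P x - ccdf P₀ x| := by
      rw [abs_sub_comm]
      exact (mul_le_mul_of_nonneg_left (le_abs_self _) (mul_nonneg hx.1.le (h0 x))).trans
        (mul_le_mul_of_nonneg_right (hk x hx') (abs_nonneg _))
    linarith

/-! ### Threshold densities and the choice of threshold -/

/-- The density `k / x` restricted to the prices `x` at which `x P̄₀(x) > ρ`. -/
noncomputable def thresholdDensity (P₀ : ProbabilityMeasure I) (k ρ x : ℝ) : ℝ :=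
  {x : ℝ | 0 < x ∧ ρ < x * ccdf P₀ x}.indicator (fun x => k / x) x

section thresholdDensity

variable (P₀ : ProbabilityMeasure I) {k ρ x : ℝ}

theorem measurable_thresholdDensity : Measurable (thresholdDensity P₀ k ρ) :=
  (measurable_const.div measurable_id).indicator
    ((measurableSet_lt measurable_const measurable_id).inter
      (measurableSet_lt measurable_const (measurable_id.mul (antitone_ccdf P₀).measurable)))

theorem thresholdDensity_nonneg (hk : 0 < k) : 0 ≤ thresholdDensity P₀ k ρ x :=
  Set.indicator_apply_nonneg fun hx => div_nonneg hk.le hx.1.le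

theorem thresholdDensity_le (hk : 0 < k) (hρ : 0 < ρ) : thresholdDensity P₀ k ρ x ≤ k / ρ := by
  refine Set.indicator_apply_le' (fun hx => ?_) fun _ => by positivity
  have : ρ ≤ x := hx.2.le.trans (mul_le_of_le_one_right hx.1.le (ccdf_le_one _ _))
  gcongr

theorem mul_thresholdDensity_le (hk : 0 < k) : x * thresholdDensity P₀ k ρ x ≤ k := by
  by_cases hx : 0 < x ∧ ρ < x * ccdf P₀ x
  · rw [thresholdDensity, Set.indicator_of_mem (by exact hx), mul_div_cancel₀ _ hx.1.ne']
  · rw [thresholdDensity, Set.indicator_of_notMem (by exact hx), mul_zero]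
    exact hk.le

theorem intervalIntegrable_thresholdDensity (hk : 0 < k) (hρ : 0 < ρ) :
    IntervalIntegrable (thresholdDensity P₀ k ρ) volume 0 1 :=
  intervalIntegrable_of_measurable_of_bound (measurable_thresholdDensity P₀) le_rfl zero_le_one
    le_rfl (C := k / ρ) fun x _ => by
      rw [abs_of_nonneg (thresholdDensity_nonneg P₀ hk)]
      exact thresholdDensity_le P₀ hk hρ

theorem intervalIntegrable_excess (hρ : 0 < ρ) :
    IntervalIntegrable (fun x => max 0 (ccdf P₀ x - ρ / x)) volume 0 1 :=
  intervalIntegrable_of_measurable_of_bound (C := 1)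
    (measurable_const.max ((antitone_ccdf P₀).measurable.sub (measurable_const.div measurable_id)))
    le_rfl zero_le_one le_rfl fun x hx => by
      have h1 : 0 ≤ ρ / x := div_nonneg hρ.le hx.1.le
      rw [abs_of_nonneg (le_max_left _ _)]
      have h2 : ccdf P₀ x - ρ / x ≤ 1 := by linarith [ccdf_le_one P₀ x]
      exact max_le zero_le_one h2

/-- Pointwise form of the duality, an equality when ρ₁ = ρ = ρ₂. The slack on both sides lets
densities with different thresholds be compared with the same excess and the same multiplier. -/
theorem le_mul_thresholdDensity_mul_ccdf (hk : 0 < k) {ρ₁ ρ₂ : ℝ} (h1 : ρ₁ ≤ ρ) (h2 : ρ ≤ ρ₂)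
    (hx : 0 < x) :
    k * max 0 (ccdf P₀ x - ρ₂ / x) + ρ₁ * thresholdDensity P₀ k ρ x ≤
      x * thresholdDensity P₀ k ρ x * ccdf P₀ x := by
  by_cases hρx : ρ < x * ccdf P₀ x
  · rw [thresholdDensity, Set.indicator_of_mem (by exact ⟨hx, hρx⟩),
      mul_div_cancel₀ _ hx.ne']
    have h3 : max 0 (ccdf P₀ x - ρ₂ / x) ≤ ccdf P₀ x - ρ₁ / x := by
      have h4 : ρ₁ / x ≤ ρ₂ / x := by gcongr; linarith
      have h5 : ρ₁ / x ≤ ccdf P₀ x := by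
        rw [div_le_iff₀' hx]
        linarith
      exact max_le (by linarith) (by linarith)
    calc _ ≤ k * (ccdf P₀ x - ρ₁ / x) + ρ₁ * (k / x) := by gcongr
      _ = _ := by ring
  · rw [thresholdDensity, Set.indicator_of_notMem (fun h => hρx h.2)]
    have h3 : ccdf P₀ x ≤ ρ₂ / x := by
      rw [le_div_iff₀' hx]
      linarith
    rw [max_eq_left (by linarith)]
    simp

theorem thresholdDensity_eq_zero (hρ : 1 ≤ ρ) (hx : x ≤ 1) : thresholdDensity P₀ k ρ x = 0 := by
  refine Set.indicator_of_notMem (fun h => ?_) _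
  have := mul_le_one₀ hx (ccdf_nonneg P₀ x) (ccdf_le_one P₀ x)
  linarith [h.2]

end thresholdDensity

/-- Complementary slackness: either the mass constraint ∫ h ≤ 1 never binds and ρ can be as small as
ε, or ρ sits near the level where the mass crosses 1. -/
theorem exists_density (P₀ : ProbabilityMeasure I) {k ε : ℝ} (hk : 0 < k) (hε : 0 < ε) :
    ∃ (h : ℝ → ℝ) (C ρ : ℝ), Measurable h ∧ (∀ x, 0 ≤ h x) ∧ (∀ x, h x ≤ C) ∧
      (∀ x, x * h x ≤ k) ∧ ∫ x in (0 : ℝ)..1, h x ≤ 1 ∧ 0 < ρ ∧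
      ρ + k * (∫ x in (0 : ℝ)..1, max 0 (ccdf P₀ x - ρ / x)) ≤
        (∫ x in (0 : ℝ)..1, x * h x * ccdf P₀ x) + ε := by
  let F : ℝ → ℝ := fun ρ => ∫ x in (0 : ℝ)..1, thresholdDensity P₀ k ρ x
  have hprod : ∀ {h : ℝ → ℝ}, Measurable h → (∀ x, 0 ≤ h x) → (∀ x, x * h x ≤ k) →
      IntervalIntegrable (fun x => x * h x * ccdf P₀ x) volume 0 1 := fun {h} hm h0 hk' =>
    intervalIntegrable_of_measurable_of_bound (C := k)
      ((measurable_id.mul hm).mul (antitone_ccdf P₀).measurable) le_rfl zero_le_one le_rfl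
      fun x hx => by
        have := mul_nonneg hx.1.le (h0 x)
        simp only [Pi.mul_apply, id]
        rw [abs_mul, abs_of_nonneg (ccdf_nonneg _ x), abs_of_nonneg this]
        exact (mul_le_of_le_one_right this (ccdf_le_one _ _)).trans (hk' x)
  by_cases hF : ∀ ρ > 0, F ρ ≤ 1
  · refine ⟨thresholdDensity P₀ k ε, k / ε, ε, measurable_thresholdDensity P₀,
      fun x => thresholdDensity_nonneg P₀ hk, fun x => thresholdDensity_le P₀ hk hε,
      fun x => mul_thresholdDensity_le P₀ hk, hF ε hε, hε, ?_⟩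
    rw [add_comm, ← intervalIntegral.integral_const_mul]
    gcongr
    refine intervalIntegral.integral_mono_on_of_le_Ioo zero_le_one
      ((intervalIntegrable_excess P₀ hε).const_mul k)
      (hprod (measurable_thresholdDensity P₀) (fun x => thresholdDensity_nonneg P₀ hk)
        fun x => mul_thresholdDensity_le P₀ hk) fun x hx => ?_
    have h1 := le_mul_thresholdDensity_mul_ccdf P₀ hk (le_refl ε) le_rfl hx.1
    have h2 := mul_nonneg hε.le (thresholdDensity_nonneg P₀ hk (ρ := ε) (x := x))
    linarith
  · push Not at hF
    obtain ⟨ρ₀, hρ₀, hFρ₀⟩ := hF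
    let S : Set ℝ := {ρ | 0 < ρ ∧ 1 < F ρ}
    have hS : ∀ ρ ∈ S, ρ ≤ 1 := by
      intro ρ hρ
      by_contra! h
      have h0 : F ρ = 0 := by
        refine (intervalIntegral.integral_congr (g := fun _ => 0) fun x hx => ?_).trans (by simp)
        rw [Set.uIcc_of_le zero_le_one] at hx
        exact thresholdDensity_eq_zero P₀ h.le hx.2
      have := hρ.2
      linarith
    have hbdd : BddAbove S := ⟨1, hS⟩
    obtain ⟨ρ₁, hρ₁, hρ₁s⟩ := exists_lt_of_lt_csSup (⟨ρ₀, hρ₀, hFρ₀⟩ : S.Nonempty)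
      (show sSup S - ε / 2 < sSup S by linarith)
    have hρ₁le : ρ₁ ≤ sSup S := le_csSup hbdd hρ₁
    set ρ₂ := sSup S + ε / 2 with hρ₂
    have hρ₁0 : 0 < ρ₁ := hρ₁.1
    have hρ₂0 : 0 < ρ₂ := by linarith
    have hF2 : F ρ₂ ≤ 1 := by
      by_contra! h
      have := le_csSup hbdd (show ρ₂ ∈ S from ⟨hρ₂0, h⟩)
      linarith
    have hF1 : 1 < F ρ₁ := hρ₁.2
    -- Weights giving the averaged density mass exactly 1; the loss is then ρ₂ - ρ₁ < ε.
    obtain ⟨a, b, ha, hb, hab, hFab⟩ : ∃ a b : ℝ, 0 ≤ a ∧ 0 ≤ b ∧ a + b = 1 ∧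
        a * F ρ₁ + b * F ρ₂ = 1 := by
      have hpos : 0 < F ρ₁ - F ρ₂ := by linarith
      refine ⟨(1 - F ρ₂) / (F ρ₁ - F ρ₂), (F ρ₁ - 1) / (F ρ₁ - F ρ₂),
        div_nonneg (by linarith) hpos.le, div_nonneg (by linarith) hpos.le, ?_, ?_⟩
      · field_simp
        ring
      · field_simp
        ring
    set h : ℝ → ℝ := fun x => a * thresholdDensity P₀ k ρ₁ x + b * thresholdDensity P₀ k ρ₂ x
      with hh
    have hm : Measurable h := ((measurable_thresholdDensity P₀).const_mul a).add
      ((measurable_thresholdDensity P₀).const_mul b)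
    have h0 : ∀ x, 0 ≤ h x := fun x =>
      add_nonneg (mul_nonneg ha (thresholdDensity_nonneg P₀ hk))
        (mul_nonneg hb (thresholdDensity_nonneg P₀ hk))
    have hxk : ∀ x, x * h x ≤ k := fun x => by
      calc x * h x = a * (x * thresholdDensity P₀ k ρ₁ x) +
            b * (x * thresholdDensity P₀ k ρ₂ x) := by simp only [hh]; ring
        _ ≤ a * k + b * k := by
          gcongr <;> exact mul_thresholdDensity_le P₀ hk
        _ = k := by rw [← add_mul, hab, one_mul]
    have hi1 := intervalIntegrable_thresholdDensity P₀ hk hρ₁0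
    have hi2 := intervalIntegrable_thresholdDensity P₀ hk hρ₂0
    have hint : IntervalIntegrable h volume 0 1 := (hi1.const_mul a).add (hi2.const_mul b)
    have hh1 : ∫ x in (0 : ℝ)..1, h x = 1 := by
      rw [hh, intervalIntegral.integral_add (hi1.const_mul a) (hi2.const_mul b),
        intervalIntegral.integral_const_mul, intervalIntegral.integral_const_mul]
      exact hFab
    refine ⟨h, a * (k / ρ₁) + b * (k / ρ₂), ρ₂, hm, h0, fun x => ?_, hxk, hh1.le, hρ₂0, ?_⟩
    · exact add_le_add (mul_le_mul_of_nonneg_left (thresholdDensity_le P₀ hk hρ₁0) ha)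
        (mul_le_mul_of_nonneg_left (thresholdDensity_le P₀ hk hρ₂0) hb)
    · have hex := (intervalIntegrable_excess P₀ hρ₂0).const_mul k
      have key : ∫ x in (0 : ℝ)..1, (k * max 0 (ccdf P₀ x - ρ₂ / x) + ρ₁ * h x) ≤
          ∫ x in (0 : ℝ)..1, x * h x * ccdf P₀ x := by
        refine intervalIntegral.integral_mono_on_of_le_Ioo zero_le_one
          (hex.add (hint.const_mul ρ₁)) (hprod hm h0 hxk) fun x hx => ?_
        have e1 := mul_le_mul_of_nonneg_left (le_mul_thresholdDensity_mul_ccdf P₀ hk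
          (le_refl ρ₁) (show ρ₁ ≤ ρ₂ by linarith) hx.1) ha
        have e2 := mul_le_mul_of_nonneg_left (le_mul_thresholdDensity_mul_ccdf P₀ hk
          (show ρ₁ ≤ ρ₂ by linarith) (le_refl ρ₂) hx.1) hb
        have e3 : k * max 0 (ccdf P₀ x - ρ₂ / x) =
            (a + b) * (k * max 0 (ccdf P₀ x - ρ₂ / x)) := by rw [hab, one_mul]
        rw [e3]
        simp only [hh]
        linarith
      rw [intervalIntegral.integral_add hex (hint.const_mul ρ₁),
        intervalIntegral.integral_const_mul, intervalIntegral.integral_const_mul, hh1] at key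
      linarith

/-! ### Assembling the equalities -/

theorem exists_nearly_optimal (P₀ : ProbabilityMeasure I) {k ε : ℝ} (hk : 0 < k) (hε : 0 < ε) :
    ∃ M ∈ mechanisms, ∃ Q : ProbabilityMeasure I, ∀ P : ProbabilityMeasure I,
      maxRevenue Q + k * wasserstein Q P₀ ≤ adjustedRevenue P₀ k M.2 P + ε := by
  obtain ⟨h, C, ρ, hm, h0, hC, hxk, hh1, hρ, hle⟩ := exists_density P₀ hk hε
  obtain ⟨M, hM, hMP⟩ := exists_mechanism_of_density P₀ hm h0 hC (fun x _ => hxk x) hh1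
  obtain ⟨Q, hQ⟩ := exists_maxRevenue_add_wasserstein_le P₀ k hρ
  exact ⟨M, hM, Q, fun P => by linarith [hMP P]⟩

theorem iSup_mechanisms_eq (P₀ : ProbabilityMeasure I) {k : ℝ} (hk : 0 < k) :
    (⨆ M ∈ mechanisms, ⨅ P : ProbabilityMeasure I, (adjustedRevenue P₀ k M.2 P : EReal)) =
      ⨅ P : ProbabilityMeasure I, ((maxRevenue P + k * wasserstein P P₀ : ℝ) : EReal) := by
  refine le_antisymm (iSup₂_le fun M hM => iInf_mono fun P => ?_) ?_
  · rw [EReal.coe_le_coe_iff, adjustedRevenue]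
    linarith [integral_payment_le_maxRevenue hM P]
  · by_contra! hlt
    -- Two reals inside the supposed gap supply a finite ε = b - a without first showing either
    -- value finite.
    obtain ⟨a, ha, hlt'⟩ := EReal.lt_iff_exists_real_btwn.1 hlt
    obtain ⟨b, hab, hb⟩ := EReal.lt_iff_exists_real_btwn.1 hlt'
    rw [EReal.coe_lt_coe_iff] at hab
    obtain ⟨M, hM, Q, hQ⟩ := exists_nearly_optimal P₀ hk (sub_pos.2 hab)
    have hbQ := hb.trans_le (iInf_le _ Q)
    rw [EReal.coe_lt_coe_iff] at hbQ
    refine absurd ha (not_lt.2 ?_)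
    refine le_trans ?_ (le_iSup₂ (f := fun (M : (I → I) × (I → ℝ)) (_ : M ∈ mechanisms) =>
      ⨅ P : ProbabilityMeasure I, (adjustedRevenue P₀ k M.2 P : EReal)) M hM)
    refine le_iInf fun P => EReal.coe_le_coe_iff.2 ?_
    linarith [hQ P]

theorem iSup_reducedMechanisms_eq (P₀ : ProbabilityMeasure I) (k : ℝ) :
    (⨆ M ∈ reducedMechanisms, ⨅ P : ProbabilityMeasure I,
      (adjustedRevenue P₀ k M.2 P : EReal)) =
    ⨆ M ∈ mechanisms, ⨅ P : ProbabilityMeasure I, (adjustedRevenue P₀ k M.2 P : EReal) := by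
  refine le_antisymm (biSup_mono fun M hM => reducedMechanisms_subset hM)
    (iSup₂_le fun M hM => ?_)
  obtain ⟨M', hM', hle⟩ := exists_reducedMechanism_ge hM
  refine le_iSup₂_of_le M' hM' (iInf_mono fun P => EReal.coe_le_coe_iff.2 ?_)
  have := integral_mono (integrable_of_monotone (monotone_payment hM) (P : Measure I))
    (integrable_of_monotone (monotone_payment (reducedMechanisms_subset hM')) _) hle
  simp only [adjustedRevenue]
  linarith

theorem wasserstein_nonneg (P P₀ : ProbabilityMeasure I) : 0 ≤ wasserstein P P₀ :=
  intervalIntegral.integral_nonneg zero_le_one fun _ _ => abs_nonneg _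

/-- Inside a ball the radius bounds the distance, and the radius equal to the distance of P is
admissible. -/
theorem iInf_maxRevenue_add_wasserstein_eq (P₀ : ProbabilityMeasure I) {k : ℝ} (hk : 0 < k) :
    (⨅ P : ProbabilityMeasure I, ((maxRevenue P + k * wasserstein P P₀ : ℝ) : EReal)) =
      ⨅ r : ℝ, ⨅ _ : 0 ≤ r,
        ((⨅ P ∈ wassersteinBall P₀ r, (maxRevenue P : EReal)) + ((k * r : ℝ) : EReal)) := by
  refine le_antisymm (le_iInf₂ fun r _ => ?_) (le_iInf fun P => ?_)
  · rw [← EReal.sub_le_iff_le_add (Or.inl (EReal.coe_ne_bot _)) (Or.inl (EReal.coe_ne_top _))]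
    refine le_iInf₂ fun P hP => ?_
    rw [EReal.sub_le_iff_le_add (Or.inl (EReal.coe_ne_bot _)) (Or.inl (EReal.coe_ne_top _))]
    refine (iInf_le _ P).trans ?_
    rw [← EReal.coe_add, EReal.coe_le_coe_iff]
    have : wasserstein P P₀ ≤ r := hP
    gcongr
  · refine (iInf₂_le (wasserstein P P₀) (wasserstein_nonneg P P₀)).trans ?_
    rw [EReal.coe_add]
    gcongr
    exact iInf₂_le P (le_refl (wasserstein P P₀))

end RobustScreening

theorem proposition1 (P₀ : ProbabilityMeasure I) (k : ℝ) (hk : 0 < k) :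
    -- the maximin value over all mechanisms that are individually rational and
    -- incentive compatible, with objective `E_P[m(v)] + k d(P, P₀)`
    ((⨆ M ∈ mechanisms, ⨅ P : ProbabilityMeasure I, (adjustedRevenue P₀ k M.2 P : EReal)) =
      ⨅ P : ProbabilityMeasure I, ((maxRevenue P + k * wasserstein P P₀ : ℝ) : EReal)) ∧
    -- the same value in reduced form, with objective `E_P[∫_0^v x dq(x)] + k d(P, P₀)`
    ((⨆ M ∈ reducedMechanisms, ⨅ P : ProbabilityMeasure I,
        (adjustedRevenue P₀ k M.2 P : EReal)) =
      ⨅ P : ProbabilityMeasure I, ((maxRevenue P + k * wasserstein P P₀ : ℝ) : EReal)) ∧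
    ((⨅ P : ProbabilityMeasure I, ((maxRevenue P + k * wasserstein P P₀ : ℝ) : EReal)) =
      ⨅ r : ℝ, ⨅ _ : 0 ≤ r,
        ((⨅ P ∈ wassersteinBall P₀ r, (maxRevenue P : EReal)) + ((k * r : ℝ) : EReal))) ∧
    -- the maxima are attained, the integrals `∫_0^v x dq(x)` exist, and the payments are integrable
    (∀ P : ProbabilityMeasure I, IsGreatest (Set.range (revenue P)) (maxRevenue P)) ∧
    (∀ q : I → I, Monotone q → ∃! m : I → ℝ, (q, m) ∈ reducedMechanisms) ∧
    (∀ M ∈ mechanisms ∪ reducedMechanisms, ∀ P : ProbabilityMeasure I,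
      Integrable M.2 (P : Measure I)) := by
  refine ⟨iSup_mechanisms_eq P₀ hk,
    (iSup_reducedMechanisms_eq P₀ k).trans (iSup_mechanisms_eq P₀ hk),
    iInf_maxRevenue_add_wasserstein_eq P₀ hk, isGreatest_maxRevenue,
    fun q hq => existsUnique_reducedMechanism hq, fun M hM P => ?_⟩
  rw [Set.union_eq_self_of_subset_right reducedMechanisms_subset] at hM
  exact integrable_of_monotone (monotone_payment hM) _
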